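/- Let $(x,y)\in\mathbb{R}^d\times\{+1,-1\}$ be random with joint probability law $p(x,y)$. Let $\pi_+=p(y=+1)$ and $r(x)=p(y=+1\mid x)$. Let $\mathcal{G}$ be a class of measurable functions $g:\mathbb{R}^d\to\mathbb{R}$, all of whose suprema over samples are measurable, and let $\ell$ be a real function. Let $C_g,C_\ell,C_r>0$ and $L_\ell\ge 0$ be constants such that - $\sup_{x}|g(x)|\le C_g$ for every $g\in\mathcal{G}$; - $0\le \ell(z)\le C_\ell$ for all $|z|\le C_g$, and $\ell$ is $L_\ell$-Lipschitz on $[-C_g,C_g]$; - $r(x)\ge C_r$ for $p(x)$-almost every $x$. Write $R(g)=\mathbb{E}_{p(x,y)}[\ell(y\,g(x))]$ for the classification risk. For an i.i.d. sample $x_1,\dots,x_n$ ($n\ge1$) from $p(x\mid y=+1)$, with confidences $r_i=r(x_i)$, let $$\widehat R(g)=\frac{\pi_+}{n}\sum_{i=1}^n\Big[\ell(g(x_i))+\frac{1-r_i}{r_i}\,\ell(-g(x_i))\Big]$$ be the empirical Pconf (positive-confidence) risk. Suppose that $g^*\in\mathcal{G}$ minimizes $R$ over $\mathcal{G}$. Let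 $$\mathfrak{R}_n(\mathcal{G})=\mathbb{E}_{x_1,\dots,x_n}\mathbb{E}_{\sigma_1,\dots,\sigma_n}\Big[\sup_{g\in\mathcal{G}}\frac1n\sum_{i=1}^n\sigma_i g(x_i)\Big]$$ be the Rademacher complexity of $\mathcal{G}$, where the $x_i$ are i.i.d. from $p(x\mid y=+1)$ and the $\sigma_i$ are independent uniform random signs. (1) For every $n\ge 1$ and every $\delta>0$, with probability at least $1-\delta$ over the sample, every minimizer $\hat g$ of $\widehat R$ over $\mathcal{G}$ satisfies $$R(\hat g)-R(g^*)\le 4\pi_+\Big(L_\ell+\frac{L_\ell}{C_r}\Big)\mathfrak{R}_n(\mathcal{G})+2\pi_+\Big(C_\ell+\frac{C_\ell}{C_r}\Big)\sqrt{\frac{\ln(2/\delta)}{2n}}.$$ (2) Consequently the method is consistent whenever $\mathfrak{R}_n(\mathcal{G})\to0$: for every $\varepsilon>0$, the probability (outer measure) that some minimizer $\hat g$ of $\widehat R$ over $\mathcal{G}$ has $R(\hat g)-R(g^*)>\varepsilon$ tends to $0$ as $n\to\infty$. -/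

import Mathlib

open MeasureTheory ProbabilityTheory Set Filter Topology
open scoped NNReal ENNReal

noncomputable section

namespace Pconf

variable {E : Type*} [MeasurableSpace E]

/-- Labels are `1, -1 : ℤˣ`; `sgn y` is the label as a real number. -/
def sgn (y : ℤˣ) : ℝ := ((y : ℤ) : ℝ)

/-- The class prior `π₊ = p(y = +1)` of the joint law `μ` of `(x, y)`. -/
def prior (μ : Measure (E × ℤˣ)) : ℝ := μ.real (Prod.snd ⁻¹' {1})

/-- The law `p(x ∣ y = +1)` of a positive pattern. -/
def posDist (μ : Measure (E × ℤˣ)) : Measure E :=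
  (ProbabilityTheory.cond μ (Prod.snd ⁻¹' {1})).map Prod.fst

/-- `r` is a version of the positive confidence `x ↦ p(y = +1 ∣ x)`, the conditional probability
of the positive label given the pattern (`μ.fst` is the law `p(x)` of the pattern). -/
structure IsConfidence (μ : Measure (E × ℤˣ)) (r : E → ℝ) : Prop where
  measurable : Measurable r
  mem_Icc : ∀ x, r x ∈ Icc (0 : ℝ) 1
  measure_eq : ∀ A : Set E, MeasurableSet A →
    μ (A ×ˢ {1}) = ∫⁻ x in A, ENNReal.ofReal (r x) ∂μ.fst

/-- The classification risk `R(g) = 𝔼 ℓ(y g(x))`. -/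
def risk (μ : Measure (E × ℤˣ)) (ℓ : ℝ → ℝ) (g : E → ℝ) : ℝ :=
  ∫ p, ℓ (sgn p.2 * g p.1) ∂μ

/-- The empirical Pconf risk of `g` on the positive patterns `S 0, …, S (n - 1)` with
confidences `r (S i)`. -/
def empRisk (μ : Measure (E × ℤˣ)) (r : E → ℝ) (ℓ : ℝ → ℝ) {n : ℕ} (S : Fin n → E)
    (g : E → ℝ) : ℝ :=
  prior μ * ((1 / (n : ℝ)) *
    ∑ i, (ℓ (g (S i)) + (1 - r (S i)) / r (S i) * ℓ (-g (S i))))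

/-- `g` minimizes the functional `F` over the class `G`. -/
def IsMinimizer (F : (E → ℝ) → ℝ) (G : Set (E → ℝ)) (g : E → ℝ) : Prop :=
  g ∈ G ∧ ∀ h ∈ G, F g ≤ F h

/-- The law of `n` independent patterns with law `P`. -/
def sampleLaw (P : Measure E) (n : ℕ) : Measure (Fin n → E) :=
  Measure.pi fun _ => P

/-- The Rademacher complexity `𝔼_S 𝔼_σ sup_{g ∈ G} (1/n) ∑ᵢ σᵢ g(xᵢ)` for samples of size `n`
from `P`; the expectation over `n` independent Rademacher signs is the mean over `{1, -1}ⁿ`. -/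
def rademacher (P : Measure E) (G : Set (E → ℝ)) (n : ℕ) : ℝ :=
  ∫ S, (1 / (2 : ℝ) ^ n) * ∑ σ : Fin n → ℤˣ,
    ⨆ g : G, (1 / (n : ℝ)) * ∑ i, sgn (σ i) * (g : E → ℝ) (S i) ∂(sampleLaw P n)

/-- The usual measurability convention for suprema over a possibly uncountable class `G`: a
supremum over `g ∈ G` of a sum of terms depending on one sample point `xᵢ` and on `g(xᵢ)`
(measurably, and continuously in `g(xᵢ)`) is a random variable. It holds for
every countable class of measurable functions, and for every pointwise bounded class that has
a countable subclass from which each member is a pointwise limit of a sequence. -/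
def HasMeasurableSups (P : Measure E) (G : Set (E → ℝ)) : Prop :=
  ∀ (m : ℕ) (ψ : Fin m → E → ℝ → ℝ),
    (∀ i, Measurable (Function.uncurry (ψ i))) → (∀ i x, Continuous (ψ i x)) →
    AEMeasurable (fun S : Fin m → E => ⨆ g : G, ∑ i, ψ i (S i) ((g : E → ℝ) (S i)))
      (sampleLaw P m)

end Pconf

end

/-! Since `r` is the conditional probability of the positive label, the law of positive patterns has
density `r / π₊` with respect to `p(x)`. Hence the risk is `π₊` times the mean, over positive
patterns alone, of `ℓ(g x) + (1 - r x) / r x * ℓ(-g x)` (`risk_eq_prior_mul_integral`), and the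
empirical Pconf risk is the matching sample average.

Let `φ` be this loss minus its value at `g*`. A minimizer of the empirical risk has a nonpositive
empirical mean of `φ`, so only one inequality is needed: true means exceed empirical means by
little, uniformly over `G`. The excess is dominated by `meanGap`, an average over an independent
ghost sample. It concentrates by McDiarmid's inequality, and its mean is at most a Rademacher
average of `φ`, by symmetrization, hence of `G` itself, by contraction. The ghost sample also keeps
every supremum a function of sample points only, as `HasMeasurableSups` requires.

Consistency follows because both terms of the bound vanish in the limit for each fixed `δ`. -/

namespace Pconf

/-! ### Averaging out one coordinate of a sample -/

section BoundedDifferences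

variable {E : Type*} [MeasurableSpace E]

instance (P : Measure E) [IsProbabilityMeasure P] (n : ℕ) :
    IsProbabilityMeasure (sampleLaw P n) := by
  unfold sampleLaw; infer_instance

lemma measurePreserving_cons (P : Measure E) [IsProbabilityMeasure P] (n : ℕ) :
    MeasurePreserving (fun p : (Fin n → E) × E => (Fin.cons p.2 p.1 : Fin (n + 1) → E))
      ((sampleLaw P n).prod P) (sampleLaw P (n + 1)) := by
  have h := ((measurePreserving_piFinSuccAbove (fun _ : Fin (n + 1) => P) 0).symm _).comp
    (Measure.measurePreserving_swap (μ := sampleLaw P n) (ν := P))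
  convert h using 1
  · funext p
    simp [MeasurableEquiv.piFinSuccAbove, Fin.consEquiv]
  · rfl

/-- The average over the first coordinate, as a lower integral, so that it inherits pointwise
bounds without any measurability of the sections. -/
noncomputable def averageHead (P : Measure E) {n : ℕ} (f : (Fin (n + 1) → E) → ℝ)
    (S : Fin n → E) : ℝ :=
  (∫⁻ x, ENNReal.ofReal (f (Fin.cons x S)) ∂P).toReal

variable {P : Measure E} [IsProbabilityMeasure P] {n : ℕ} {f : (Fin (n + 1) → E) → ℝ} {B c : ℝ}

lemma lintegral_head_le (hB : ∀ S, f S ≤ B) (S : Fin n → E) :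
    ∫⁻ x, ENNReal.ofReal (f (Fin.cons x S)) ∂P ≤ ENNReal.ofReal B := by
  refine (lintegral_mono fun x => ENNReal.ofReal_le_ofReal (hB _)).trans ?_
  simp

lemma averageHead_mem_Icc (h0 : ∀ S, 0 ≤ f S) (hB : ∀ S, f S ≤ B) (S : Fin n → E) :
    averageHead P f S ∈ Icc 0 B := by
  refine ⟨ENNReal.toReal_nonneg, ?_⟩
  have : Nonempty E := nonempty_of_isProbabilityMeasure P
  have hB0 : 0 ≤ B := (h0 (fun _ => Classical.arbitrary E)).trans (hB _)
  exact ENNReal.toReal_le_of_le_ofReal hB0 (lintegral_head_le hB S)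

/-- Averaging preserves bounded differences at every point, not just almost everywhere; this lets
the induction for McDiarmid's inequality continue. Monotonicity of the lower integral suffices. -/
lemma averageHead_update_le (hB : ∀ S, f S ≤ B) (hc : 0 ≤ c)
    (hd : ∀ S i x, f (Function.update S i x) ≤ f S + c) (S : Fin n → E) (i : Fin n) (y : E) :
    averageHead P f (Function.update S i y) ≤ averageHead P f S + c := by
  have hfin : ∀ S : Fin n → E, ∫⁻ x, ENNReal.ofReal (f (Fin.cons x S)) ∂P ≠ ∞ := fun S =>
    ((lintegral_head_le hB S).trans_lt ENNReal.ofReal_lt_top).ne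
  have h : ∫⁻ x, ENNReal.ofReal (f (Fin.cons x (Function.update S i y))) ∂P
      ≤ ∫⁻ x, ENNReal.ofReal (f (Fin.cons x S)) ∂P + ENNReal.ofReal c := by
    calc _ ≤ ∫⁻ x, (ENNReal.ofReal (f (Fin.cons x S)) + ENNReal.ofReal c) ∂P := by
          refine lintegral_mono fun x => ?_
          rw [Fin.cons_update]
          exact (ENNReal.ofReal_le_ofReal (hd _ _ _)).trans ENNReal.ofReal_add_le
      _ = _ := by rw [lintegral_add_right _ measurable_const]; simp
  have := ENNReal.toReal_mono (by simp [hfin]) h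
  rwa [ENNReal.toReal_add (hfin S) (by simp), ENNReal.toReal_ofReal hc] at this

lemma aemeasurable_comp_cons (hf : AEMeasurable f (sampleLaw P (n + 1))) :
    AEMeasurable (fun p : (Fin n → E) × E => f (Fin.cons p.2 p.1)) ((sampleLaw P n).prod P) :=
  hf.comp_quasiMeasurePreserving (measurePreserving_cons P n).quasiMeasurePreserving

lemma aemeasurable_averageHead (hf : AEMeasurable f (sampleLaw P (n + 1))) :
    AEMeasurable (averageHead P f) (sampleLaw P n) :=
  ((aemeasurable_comp_cons hf).ennreal_ofReal.lintegral_prod_right').ennreal_toReal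

lemma ae_averageHead_eq (hf : AEMeasurable f (sampleLaw P (n + 1))) (h0 : ∀ S, 0 ≤ f S) :
    ∀ᵐ S ∂(sampleLaw P n), AEMeasurable (fun x => f (Fin.cons x S)) P ∧
      averageHead P f S = ∫ x, f (Fin.cons x S) ∂P := by
  filter_upwards [(aemeasurable_comp_cons hf).aestronglyMeasurable.prodMk_left] with S hS
  exact ⟨hS.aemeasurable,
    (integral_eq_lintegral_of_nonneg_ae (Eventually.of_forall fun x => h0 _) hS).symm⟩

lemma integral_averageHead (hf : AEMeasurable f (sampleLaw P (n + 1))) (h0 : ∀ S, 0 ≤ f S)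
    (hB : ∀ S, f S ≤ B) :
    ∫ S, averageHead P f S ∂(sampleLaw P n) = ∫ S, f S ∂(sampleLaw P (n + 1)) := by
  have hint : Integrable (fun p : (Fin n → E) × E => f (Fin.cons p.2 p.1))
      ((sampleLaw P n).prod P) :=
    Integrable.of_bound (aemeasurable_comp_cons hf).aestronglyMeasurable B
      (Eventually.of_forall fun p => by rw [Real.norm_of_nonneg (h0 _)]; exact hB _)
  rw [integral_congr_ae ((ae_averageHead_eq hf h0).mono fun S h => h.2),
    ← integral_prod _ hint, ← (measurePreserving_cons P n).map_eq, integral_map]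
  · exact (measurePreserving_cons P n).measurable.aemeasurable
  · rw [(measurePreserving_cons P n).map_eq]; exact hf.aestronglyMeasurable

lemma integrable_exp_of_abs_le {Ω : Type*} [MeasurableSpace Ω] {μ : Measure Ω}
    [IsFiniteMeasure μ] {X : Ω → ℝ} (hX : AEMeasurable X μ) {b : ℝ} (hb : ∀ ω, |X ω| ≤ b)
    (t m : ℝ) : Integrable (fun ω => Real.exp (t * (X ω - m))) μ := by
  refine Integrable.of_bound (C := Real.exp (|t| * (b + |m|))) ?_ ?_
  · exact (Real.measurable_exp.comp_aemeasurable
      ((hX.sub_const m).const_mul t)).aestronglyMeasurable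
  · refine Eventually.of_forall fun ω => ?_
    rw [Real.norm_of_nonneg (Real.exp_pos _).le]
    refine Real.exp_le_exp.2 ((le_abs_self _).trans ?_)
    rw [abs_mul]
    exact mul_le_mul_of_nonneg_left ((abs_sub _ _).trans (by gcongr; exact hb ω)) (abs_nonneg t)

end BoundedDifferences

/-! ### McDiarmid's inequality -/

section McDiarmid

variable {E : Type*} [MeasurableSpace E] {P : Measure E} [IsProbabilityMeasure P]

/-- Induction on the sample size. With the tail fixed, the first point moves `f` within an interval
of length `c`, so Hoeffding's lemma pays one factor `exp((c/2)² t² / 2)` for replacing `f` by its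
average over that point. The average has the same mean and the same bounded differences. -/
theorem integral_exp_le_of_bounded_differences {B c : ℝ} (hc : 0 ≤ c) (t : ℝ) :
    ∀ (n : ℕ) (f : (Fin n → E) → ℝ), AEMeasurable f (sampleLaw P n) →
      (∀ S, 0 ≤ f S) → (∀ S, f S ≤ B) → (∀ S i x, f (Function.update S i x) ≤ f S + c) →
      ∫ S, Real.exp (t * (f S - ∫ T, f T ∂(sampleLaw P n))) ∂(sampleLaw P n) ≤
        Real.exp (n * ((c / 2) ^ 2 * t ^ 2 / 2)) := by
  intro n
  induction n with
  | zero =>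
    intro f _ _ _ _
    have hS : ∀ S, f S = f default := fun S => congrArg f (Subsingleton.elim _ _)
    simp [hS]
  | succ n ih =>
    intro f hf h0 hB hd
    have : Nonempty E := nonempty_of_isProbabilityMeasure P
    set m := ∫ T, f T ∂(sampleLaw P (n + 1)) with hm
    have habs : ∀ S, |f S| ≤ B := fun S => by rw [abs_of_nonneg (h0 S)]; exact hB S
    have hF := averageHead_mem_Icc (P := P) h0 hB
    have hFabs : ∀ S : Fin n → E, |averageHead P f S| ≤ B := fun S => by
      rw [abs_of_nonneg (hF S).1]; exact (hF S).2
    have key := ih (averageHead P f) (aemeasurable_averageHead hf) (fun S => (hF S).1)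
      (fun S => (hF S).2) (averageHead_update_le hB hc hd)
    rw [integral_averageHead hf h0 hB, ← hm] at key
    have hint := integrable_exp_of_abs_le (aemeasurable_comp_cons hf) (fun p => habs _) t m
    have hsection : ∀ᵐ S ∂(sampleLaw P n),
        ∫ x, Real.exp (t * (f (Fin.cons x S) - m)) ∂P ≤
          Real.exp ((c / 2) ^ 2 * t ^ 2 / 2) * Real.exp (t * (averageHead P f S - m)) := by
      filter_upwards [ae_averageHead_eq hf h0] with S hS
      obtain ⟨hmeas, heq⟩ := hS
      have hbdd : BddBelow (range fun x : E => f (Fin.cons x S)) :=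
        ⟨0, by rintro _ ⟨x, rfl⟩; exact h0 _⟩
      -- Anchoring the interval at the infimum gives length `c`, rather than the `2c` of an interval
      -- centred at a value of `f`.
      have hosc : ∀ x, f (Fin.cons x S) ∈
          Icc (⨅ x, f (Fin.cons x S)) ((⨅ x, f (Fin.cons x S)) + c) := fun x => by
        refine ⟨ciInf_le hbdd x, ?_⟩
        rw [← sub_le_iff_le_add]
        refine le_ciInf fun y => ?_
        have := hd (Fin.cons y S) 0 x
        rw [Fin.update_cons_zero] at this
        linarith
      have hH := (hasSubgaussianMGF_of_mem_Icc hmeas (Eventually.of_forall hosc)).mgf_le t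
      rw [mgf, ← heq] at hH
      have hcast : (((‖(⨅ x, f (Fin.cons x S)) + c - ⨅ x, f (Fin.cons x S)‖₊ / 2) ^ 2 : ℝ≥0) : ℝ)
          = (c / 2) ^ 2 := by
        simp [abs_of_nonneg hc]
      rw [hcast] at hH
      calc ∫ x, Real.exp (t * (f (Fin.cons x S) - m)) ∂P
          = (∫ x, Real.exp (t * (f (Fin.cons x S) - averageHead P f S)) ∂P)
              * Real.exp (t * (averageHead P f S - m)) := by
            rw [← integral_mul_const]
            refine integral_congr_ae (Eventually.of_forall fun x => ?_)
            simp only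
            rw [← Real.exp_add]; ring_nf
        _ ≤ _ := mul_le_mul_of_nonneg_right hH (Real.exp_pos _).le
    calc ∫ S, Real.exp (t * (f S - m)) ∂(sampleLaw P (n + 1))
        = ∫ S, ∫ x, Real.exp (t * (f (Fin.cons x S) - m)) ∂P ∂(sampleLaw P n) := by
          rw [← integral_prod _ hint, ← (measurePreserving_cons P n).map_eq, integral_map]
          · exact (measurePreserving_cons P n).measurable.aemeasurable
          · rw [(measurePreserving_cons P n).map_eq]
            exact (integrable_exp_of_abs_le hf habs t m).aestronglyMeasurable
      _ ≤ ∫ S, Real.exp ((c / 2) ^ 2 * t ^ 2 / 2) * Real.exp (t * (averageHead P f S - m))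
            ∂(sampleLaw P n) :=
          integral_mono_ae hint.integral_prod_left
            ((integrable_exp_of_abs_le (aemeasurable_averageHead hf) hFabs t m).const_mul _)
            hsection
      _ ≤ Real.exp ((c / 2) ^ 2 * t ^ 2 / 2) * Real.exp (n * ((c / 2) ^ 2 * t ^ 2 / 2)) := by
          rw [integral_const_mul]
          exact mul_le_mul_of_nonneg_left key (Real.exp_pos _).le
      _ = _ := by rw [← Real.exp_add]; push_cast; ring_nf

/-- **McDiarmid's inequality** for a bounded function of `n` independent points that changes by at
most `c` when one point is changed. -/
theorem measure_ge_le_of_bounded_differences {B c : ℝ} (hc : 0 ≤ c) {n : ℕ}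
    {f : (Fin n → E) → ℝ} (hf : AEMeasurable f (sampleLaw P n)) (h0 : ∀ S, 0 ≤ f S)
    (hB : ∀ S, f S ≤ B) (hd : ∀ S i x, f (Function.update S i x) ≤ f S + c)
    {ε : ℝ} (hε : 0 ≤ ε) :
    (sampleLaw P n).real {S | ε ≤ f S - ∫ T, f T ∂(sampleLaw P n)} ≤
      Real.exp (-ε ^ 2 / (2 * (n * (c / 2) ^ 2))) := by
  have h : HasSubgaussianMGF (fun S => f S - ∫ T, f T ∂(sampleLaw P n))
      (NNReal.mk (n * (c / 2) ^ 2) (by positivity)) (sampleLaw P n) := by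
    refine ⟨fun t => integrable_exp_of_abs_le hf (b := B) (fun S => ?_) t _, fun t => ?_⟩
    · rw [abs_of_nonneg (h0 S)]; exact hB S
    · refine (integral_exp_le_of_bounded_differences hc t n f hf h0 hB hd).trans (le_of_eq ?_)
      rw [NNReal.coe_mk]
      ring_nf
  exact h.measure_ge_le hε

end McDiarmid

/-! ### Contraction for Rademacher averages -/

section Contraction

@[simp] lemma sgn_one : sgn 1 = 1 := by simp [sgn]

@[simp] lemma sgn_neg_one : sgn (-1) = -1 := by simp [sgn]

@[simp] lemma sgn_neg (y : ℤˣ) : sgn (-y) = -sgn y := by simp [sgn]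

lemma sgn_eq_one_or (y : ℤˣ) : sgn y = 1 ∨ sgn y = -1 := by
  rcases Int.units_eq_one_or y with rfl | rfl <;> simp

@[simp] lemma abs_sgn (y : ℤˣ) : |sgn y| = 1 := by
  rcases sgn_eq_one_or y with h | h <;> simp [h]

variable {ι : Type*}

lemma bddAbove_of_abs_le {F : ι → ℝ} (h : ∃ C, ∀ g, |F g| ≤ C) : BddAbove (range F) := by
  obtain ⟨C, hC⟩ := h
  exact ⟨C, by rintro _ ⟨g, rfl⟩; exact (le_abs_self _).trans (hC g)⟩

lemma exists_abs_add_le {F H : ι → ℝ} (hF : ∃ C, ∀ g, |F g| ≤ C) (hH : ∃ C, ∀ g, |H g| ≤ C) :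
    ∃ C, ∀ g, |F g + H g| ≤ C := by
  obtain ⟨C, hC⟩ := hF
  obtain ⟨D, hD⟩ := hH
  exact ⟨C + D, fun g => (abs_add_le _ _).trans (add_le_add (hC g) (hD g))⟩

lemma exists_abs_sgn_mul_le {F : ι → ℝ} (hF : ∃ C, ∀ g, |F g| ≤ C) (s : ℤˣ) :
    ∃ C, ∀ g, |sgn s * F g| ≤ C := by
  simpa [abs_mul] using hF

lemma exists_abs_sum_le {κ : Type*} (s : Finset κ) {F : κ → ι → ℝ}
    (hF : ∀ i, ∃ C, ∀ g, |F i g| ≤ C) : ∃ C, ∀ g, |∑ i ∈ s, F i g| ≤ C := by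
  choose C hC using hF
  exact ⟨∑ i ∈ s, C i, fun g => (Finset.abs_sum_le_sum_abs _ _).trans
    (Finset.sum_le_sum fun i _ => hC i g)⟩

/-- The one-sign case of contraction. For near-maximizers `g`, `h` of the two left suprema, `v g - v
h` is at most `u g - u h` or `u h - u g`; in the second case `g` and `h` trade places in the right
suprema, which is harmless because `b g + b h` is symmetric. -/
lemma iSup_add_add_iSup_sub_le [Nonempty ι] {b u v : ι → ℝ} (hb : ∃ C, ∀ g, |b g| ≤ C)
    (hu : ∃ C, ∀ g, |u g| ≤ C) (huv : ∀ g h, |v g - v h| ≤ |u g - u h|) :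
    (⨆ g, (b g + sgn 1 * v g)) + (⨆ g, (b g + sgn (-1) * v g)) ≤
      (⨆ g, (b g + sgn 1 * u g)) + ⨆ g, (b g + sgn (-1) * u g) := by
  have h1 := bddAbove_of_abs_le (exists_abs_add_le hb (exists_abs_sgn_mul_le hu 1))
  have h2 := bddAbove_of_abs_le (exists_abs_add_le hb (exists_abs_sgn_mul_le hu (-1)))
  rw [← le_sub_iff_add_le]
  refine ciSup_le fun g => ?_
  rw [le_sub_comm]
  refine ciSup_le fun h => ?_
  rw [le_sub_iff_add_le]
  have hv := (le_abs_self _).trans (huv g h)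
  rcases abs_cases (u g - u h) with ⟨e, _⟩ | ⟨e, _⟩
  · have := le_ciSup h1 g
    have := le_ciSup h2 h
    simp only [sgn_one, sgn_neg_one] at *
    linarith
  · have := le_ciSup h1 h
    have := le_ciSup h2 g
    simp only [sgn_one, sgn_neg_one] at *
    linarith

lemma sum_signs_succ {n : ℕ} (F : (Fin (n + 1) → ℤˣ) → ℝ) :
    ∑ σ, F σ = ∑ τ : Fin n → ℤˣ, (F (Fin.cons 1 τ) + F (Fin.cons (-1) τ)) := by
  rw [← (Fin.consEquiv fun _ : Fin (n + 1) => ℤˣ).sum_comp, Fintype.sum_prod_type,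
    Finset.sum_comm]
  refine Finset.sum_congr rfl fun τ _ => ?_
  rw [UnitsInt.univ, Finset.sum_pair (by decide)]
  rfl

/-- The **contraction principle** for Rademacher averages, in comparison form. -/
theorem sum_iSup_signs_le [Nonempty ι] (n : ℕ) : ∀ (b : ι → ℝ) (u v : Fin n → ι → ℝ),
    (∃ C, ∀ g, |b g| ≤ C) → (∀ i, ∃ C, ∀ g, |u i g| ≤ C) → (∀ i, ∃ C, ∀ g, |v i g| ≤ C) →
    (∀ i g h, |v i g - v i h| ≤ |u i g - u i h|) →
    ∑ σ : Fin n → ℤˣ, (⨆ g, (b g + ∑ i, sgn (σ i) * v i g)) ≤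
      ∑ σ : Fin n → ℤˣ, ⨆ g, (b g + ∑ i, sgn (σ i) * u i g) := by
  induction n with
  | zero => intro b u v _ _ _ _; simp
  | succ n ih =>
    intro b u v hb hu hv huv
    -- With the first sign fixed, its term is absorbed into the offset `b`, and the induction
    -- hypothesis exchanges the other `v i` for `u i`. The first term is exchanged afterwards, by
    -- pairing its two signs.
    have step : ∀ s : ℤˣ, ∑ τ : Fin n → ℤˣ,
        (⨆ g, (b g + ∑ i, sgn ((Fin.cons s τ : Fin (n + 1) → ℤˣ) i) * v i g)) ≤
        ∑ τ : Fin n → ℤˣ, ⨆ g, (b g + ∑ i, sgn (τ i) * u i.succ g + sgn s * v 0 g) := by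
      intro s
      have := ih (fun g => b g + sgn s * v 0 g) (fun i => u i.succ) (fun i => v i.succ)
        (exists_abs_add_le hb (exists_abs_sgn_mul_le (hv 0) s)) (fun i => hu _) (fun i => hv _)
        (fun i => huv _)
      convert this using 4 with τ _ g τ _ g
      · simp [Fin.sum_univ_succ, add_assoc]
      · ring
    rw [sum_signs_succ, sum_signs_succ, Finset.sum_add_distrib]
    refine (add_le_add (step 1) (step (-1))).trans ?_
    rw [← Finset.sum_add_distrib]
    refine Finset.sum_le_sum fun τ _ => ?_
    have hb' : ∃ C, ∀ g, |b g + ∑ i, sgn (τ i) * u i.succ g| ≤ C :=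
      exists_abs_add_le hb (exists_abs_sum_le _ fun i => exists_abs_sgn_mul_le (hu i.succ) (τ i))
    refine (iSup_add_add_iSup_sub_le hb' (hu 0) (huv 0)).trans (le_of_eq ?_)
    congr 2 <;>
    · funext g
      simp [Fin.sum_univ_succ]
      ring

end Contraction

/-! ### Joining two samples and exchanging their points -/

section Sampling

variable {E : Type*} [MeasurableSpace E]

/-- Lets a pair of samples be treated as one longer sample, so that the measurability convention for
a single sample applies to `supGap`. -/
lemma measurePreserving_append (P : Measure E) [IsProbabilityMeasure P] (m n : ℕ) :
    MeasurePreserving (fun p : (Fin m → E) × (Fin n → E) => Fin.append p.1 p.2)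
      ((sampleLaw P m).prod (sampleLaw P n)) (sampleLaw P (m + n)) := by
  have hmeas : Measurable (fun p : (Fin m → E) × (Fin n → E) => Fin.append p.1 p.2) := by
    refine measurable_pi_lambda _ fun i => ?_
    refine Fin.addCases (fun j => ?_) (fun j => ?_) i
    · simpa [Function.comp_def] using (measurable_pi_apply j).comp measurable_fst
    · simpa [Function.comp_def] using (measurable_pi_apply j).comp measurable_snd
  refine ⟨hmeas, (Measure.pi_eq fun s hs => ?_).symm⟩
  have hpre : (fun p : (Fin m → E) × (Fin n → E) => Fin.append p.1 p.2) ⁻¹' (univ.pi s) =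
      (univ.pi fun i => s (Fin.castAdd n i)) ×ˢ (univ.pi fun i => s (Fin.natAdd m i)) := by
    ext p
    simp only [mem_preimage, mem_univ_pi, mem_prod]
    refine ⟨fun h => ⟨fun i => by simpa using h (Fin.castAdd n i),
      fun i => by simpa using h (Fin.natAdd m i)⟩, fun h i => ?_⟩
    refine Fin.addCases (fun j => ?_) (fun j => ?_) i
    · simpa using h.1 j
    · simpa using h.2 j
  rw [Measure.map_apply hmeas (MeasurableSet.univ_pi hs), hpre, Measure.prod_prod,
    sampleLaw, sampleLaw, Measure.pi_pi, Measure.pi_pi, Fin.prod_univ_add]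

/-- Exchange the `i`-th points of two samples wherever `σ i = -1`. -/
def exchange {n : ℕ} (σ : Fin n → ℤˣ) (p : (Fin n → E) × (Fin n → E)) :
    (Fin n → E) × (Fin n → E) :=
  (fun i => if σ i = 1 then p.1 i else p.2 i, fun i => if σ i = 1 then p.2 i else p.1 i)

/-- Viewed as a sequence of independent pairs, the two samples undergo a coordinatewise swap, and
each swap preserves `P.prod P`. -/
lemma measurePreserving_exchange (P : Measure E) [IsProbabilityMeasure P] {n : ℕ}
    (σ : Fin n → ℤˣ) :
    MeasurePreserving (exchange σ) ((sampleLaw P n).prod (sampleLaw P n))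
      ((sampleLaw P n).prod (sampleLaw P n)) := by
  have he := measurePreserving_arrowProdEquivProdArrow E E (Fin n) (fun _ => P) (fun _ => P)
  have hswap : ∀ i, MeasurePreserving (fun q : E × E => if σ i = 1 then q else q.swap)
      (P.prod P) (P.prod P) := fun i => by
    by_cases h : σ i = 1
    · simpa only [h, if_true] using! MeasurePreserving.id (P.prod P)
    · simpa [h] using Measure.measurePreserving_swap (μ := P) (ν := P)
  have h := (he.comp (measurePreserving_pi (fun _ => P.prod P) (fun _ => P.prod P) hswap)).comp
    (he.symm _)
  change MeasurePreserving _ ((Measure.pi _).prod (Measure.pi _))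
    ((Measure.pi _).prod (Measure.pi _))
  convert h using 1
  funext p
  ext i <;> by_cases h : σ i = 1 <;>
    simp [exchange, MeasurableEquiv.arrowProdEquivProdArrow, Equiv.arrowProdEquivProdArrow, h]

end Sampling

/-! ### The gap between two samples: pointwise bounds -/

section Gap

variable {E : Type*}

/-- The supremum over `g ∈ G` of the signed sum of `φ xᵢ (g xᵢ)`. -/
noncomputable def signedSup (G : Set (E → ℝ)) (φ : E → ℝ → ℝ) {n : ℕ} (σ : Fin n → ℤˣ)
    (S : Fin n → E) : ℝ :=
  ⨆ g : G, ∑ i, sgn (σ i) * φ (S i) ((g : E → ℝ) (S i))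

/-- The largest increase, over `g ∈ G`, of the sum of `φ xᵢ (g xᵢ)` from one sample to another. -/
noncomputable def supGap (G : Set (E → ℝ)) (φ : E → ℝ → ℝ) {n : ℕ} (S T : Fin n → E) : ℝ :=
  ⨆ g : G, (∑ i, φ (T i) ((g : E → ℝ) (T i)) - ∑ i, φ (S i) ((g : E → ℝ) (S i)))

variable {G : Set (E → ℝ)} {g₀ : E → ℝ} {φ : E → ℝ → ℝ} {M : ℝ} {n : ℕ}

lemma abs_sum_loss_le (hM : ∀ g ∈ G, ∀ x, |φ x (g x)| ≤ M) (S : Fin n → E) (g : G) :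
    |∑ i, φ (S i) ((g : E → ℝ) (S i))| ≤ n * M := by
  refine (Finset.abs_sum_le_sum_abs _ _).trans ((Finset.sum_le_sum fun i _ => hM g g.2 _).trans ?_)
  simp

lemma abs_signed_sum_loss_le (hM : ∀ g ∈ G, ∀ x, |φ x (g x)| ≤ M) (σ : Fin n → ℤˣ)
    (S : Fin n → E) (g : G) : |∑ i, sgn (σ i) * φ (S i) ((g : E → ℝ) (S i))| ≤ n * M := by
  refine (Finset.abs_sum_le_sum_abs _ _).trans
    ((Finset.sum_le_sum (g := fun _ => M) fun i _ => ?_).trans (by simp))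
  rw [abs_mul, abs_sgn, one_mul]
  exact hM g g.2 _

lemma abs_gap_le (hM : ∀ g ∈ G, ∀ x, |φ x (g x)| ≤ M) (S T : Fin n → E) (g : G) :
    |∑ i, φ (T i) ((g : E → ℝ) (T i)) - ∑ i, φ (S i) ((g : E → ℝ) (S i))| ≤ 2 * (n * M) := by
  refine (abs_sub _ _).trans ?_
  linarith [abs_sum_loss_le hM S g, abs_sum_loss_le hM T g]

lemma abs_iSup_le [Nonempty G] {F : G → ℝ} {C : ℝ} (h : ∀ g, |F g| ≤ C) : |⨆ g, F g| ≤ C := by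
  rw [abs_le]
  refine ⟨?_, ciSup_le fun g => (le_abs_self _).trans (h g)⟩
  obtain ⟨g⟩ := ‹Nonempty G›
  exact (abs_le.1 (h g)).1.trans (le_ciSup (bddAbove_of_abs_le ⟨C, h⟩) g)

/-- The member `g₀` contributes zero. Nonnegativity ensures that `ENNReal.ofReal` loses nothing when
the gap is averaged by a lower integral. -/
lemma supGap_nonneg (hM : ∀ g ∈ G, ∀ x, |φ x (g x)| ≤ M) (hg₀ : g₀ ∈ G)
    (hφ₀ : ∀ x, φ x (g₀ x) = 0) (S T : Fin n → E) : 0 ≤ supGap G φ S T := by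
  refine le_ciSup_of_le (bddAbove_of_abs_le ⟨_, abs_gap_le hM S T⟩) ⟨g₀, hg₀⟩ ?_
  simp [hφ₀]

lemma supGap_le [Nonempty G] (hM : ∀ g ∈ G, ∀ x, |φ x (g x)| ≤ M) (S T : Fin n → E) :
    supGap G φ S T ≤ 2 * (n * M) :=
  (le_abs_self _).trans (abs_iSup_le (abs_gap_le hM S T))

lemma supGap_update_le [Nonempty G] (hM : ∀ g ∈ G, ∀ x, |φ x (g x)| ≤ M) (S T : Fin n → E)
    (i : Fin n) (x : E) : supGap G φ (Function.update S i x) T ≤ supGap G φ S T + 2 * M := by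
  refine ciSup_le fun g => ?_
  have hsum : ∑ j, φ (S j) ((g : E → ℝ) (S j)) -
      ∑ j, φ (Function.update S i x j) ((g : E → ℝ) (Function.update S i x j)) =
      φ (S i) ((g : E → ℝ) (S i)) - φ x ((g : E → ℝ) x) := by
    rw [← Finset.sum_sub_distrib, Finset.sum_eq_single i]
    · simp
    · intro j _ hj; simp [hj]
    · simp
  have h1 := le_ciSup (bddAbove_of_abs_le ⟨_, abs_gap_le hM S T⟩) g
  have h2 := abs_le.1 (hM g g.2 (S i))
  have h3 := abs_le.1 (hM g g.2 x)
  have h4 : (∑ i, φ (T i) ((g : E → ℝ) (T i)) - ∑ i, φ (S i) ((g : E → ℝ) (S i))) ≤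
    supGap G φ S T := h1
  linarith

/-- Exchanging multiplies the `i`-th difference by `σ i`; the supremum of the signed differences
then splits by subadditivity. -/
lemma supGap_exchange_le [Nonempty G] (hM : ∀ g ∈ G, ∀ x, |φ x (g x)| ≤ M) (σ : Fin n → ℤˣ)
    (p : (Fin n → E) × (Fin n → E)) :
    supGap G φ (exchange σ p).1 (exchange σ p).2 ≤
      signedSup G φ σ p.2 + signedSup G φ (-σ) p.1 := by
  refine ciSup_le fun g => ?_
  have h1 := le_ciSup (bddAbove_of_abs_le ⟨_, abs_signed_sum_loss_le hM σ p.2⟩) g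
  have h2 := le_ciSup (bddAbove_of_abs_le ⟨_, abs_signed_sum_loss_le hM (-σ) p.1⟩) g
  refine le_trans (le_of_eq ?_) (add_le_add h1 h2)
  rw [← Finset.sum_sub_distrib, ← Finset.sum_add_distrib]
  refine Finset.sum_congr rfl fun i _ => ?_
  rcases Int.units_eq_one_or (σ i) with h | h
  · simp [exchange, h]; ring
  · simp [exchange, h]; ring

lemma sum_signedSup_le_mul [Nonempty G] {K : ℝ≥0} (hM : ∀ g ∈ G, ∀ x, |φ x (g x)| ≤ M) {Cg : ℝ}
    (hCg : ∀ g ∈ G, ∀ x, |g x| ≤ Cg) (hK : ∀ x, LipschitzWith K (φ x)) (S : Fin n → E) :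
    ∑ σ : Fin n → ℤˣ, signedSup G φ σ S ≤
      K * ∑ σ : Fin n → ℤˣ, signedSup G (fun _ z => z) σ S := by
  have h := sum_iSup_signs_le (ι := G) n (fun _ => 0)
    (fun i g => K * (g : E → ℝ) (S i)) (fun i g => φ (S i) ((g : E → ℝ) (S i)))
    ⟨0, by simp⟩ (fun i => ⟨K * Cg, fun g => ?_⟩) (fun i => ⟨M, fun g => hM g g.2 _⟩) ?_
  · simp only [zero_add] at h
    refine h.trans (le_of_eq ?_)
    rw [Finset.mul_sum]
    refine Finset.sum_congr rfl fun σ _ => ?_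
    rw [signedSup, Real.mul_iSup_of_nonneg K.coe_nonneg]
    congr 1
    funext g
    rw [Finset.mul_sum]
    exact Finset.sum_congr rfl fun i _ => by ring
  · rw [abs_mul, abs_of_nonneg K.coe_nonneg]
    exact mul_le_mul_of_nonneg_left (hCg g g.2 _) K.coe_nonneg
  · intro i g g'
    rw [← mul_sub, abs_mul, abs_of_nonneg K.coe_nonneg]
    simpa [Real.dist_eq] using (hK (S i)).dist_le_mul ((g : E → ℝ) (S i)) ((g' : E → ℝ) (S i))

end Gap

/-! ### Symmetrization: the mean gap and the Rademacher complexity -/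

section Gap

variable {E : Type*} [MeasurableSpace E] {P : Measure E} {G : Set (E → ℝ)} {g₀ : E → ℝ}
  {φ : E → ℝ → ℝ} {M : ℝ} {n : ℕ}

lemma aemeasurable_signedSup (hG : HasMeasurableSups P G) (hφ : Measurable (Function.uncurry φ))
    (hφc : ∀ x, Continuous (φ x)) (σ : Fin n → ℤˣ) :
    AEMeasurable (signedSup G φ σ) (sampleLaw P n) :=
  hG n (fun i x z => sgn (σ i) * φ x z) (fun _ => hφ.const_mul _)
    (fun _ x => (hφc x).const_mul _)

lemma rademacher_nonneg {Cg : ℝ}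
    (hCg : ∀ g ∈ G, ∀ x, |g x| ≤ Cg) (hg₀ : g₀ ∈ G) : 0 ≤ rademacher P G n := by
  refine integral_nonneg fun S => mul_nonneg (by positivity) ?_
  have hle : ∀ σ : Fin n → ℤˣ, (1 / (n : ℝ)) * ∑ i, sgn (σ i) * g₀ (S i) ≤
      ⨆ g : G, (1 / (n : ℝ)) * ∑ i, sgn (σ i) * (g : E → ℝ) (S i) := fun σ =>
    le_ciSup (f := fun g : G => (1 / (n : ℝ)) * ∑ i, sgn (σ i) * (g : E → ℝ) (S i))
      (bddAbove_of_abs_le ⟨(1 / (n : ℝ)) * (n * Cg), fun g => by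
        rw [abs_mul, abs_of_nonneg (by positivity)]
        exact mul_le_mul_of_nonneg_left
          (abs_signed_sum_loss_le (φ := fun _ z => z) hCg σ S g) (by positivity)⟩) ⟨g₀, hg₀⟩
  refine le_trans (le_of_eq ?_) (Finset.sum_le_sum fun σ _ => hle σ)
  -- The flip `σ ↦ -σ` shows that the signed averages of the single function `g₀` sum to zero.
  have hneg := Equiv.sum_comp (Equiv.neg (Fin n → ℤˣ))
    (fun σ => (1 / (n : ℝ)) * ∑ i, sgn (σ i) * g₀ (S i))
  simp only [Equiv.neg_apply, Pi.neg_apply, sgn_neg, neg_mul, Finset.sum_neg_distrib,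
    mul_neg] at hneg
  linarith

variable [IsProbabilityMeasure P]

/-- The gap is a signed supremum over the concatenated sample, with signs `-1` on the first half and
`1` on the second. -/
lemma aemeasurable_supGap (hG : HasMeasurableSups P G) (hφ : Measurable (Function.uncurry φ))
    (hφc : ∀ x, Continuous (φ x)) :
    AEMeasurable (fun p : (Fin n → E) × (Fin n → E) => supGap G φ p.1 p.2)
      ((sampleLaw P n).prod (sampleLaw P n)) := by
  have h := (aemeasurable_signedSup (n := n + n) hG hφ hφc
    (Fin.append (fun _ => -1) (fun _ => 1))).comp_quasiMeasurePreserving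
    (measurePreserving_append P n n).quasiMeasurePreserving
  refine h.congr (Eventually.of_forall fun p => ?_)
  simp only [Function.comp, signedSup, supGap, Fin.sum_univ_add, Fin.append_left,
    Fin.append_right, sgn_one, sgn_neg_one, one_mul, neg_mul, Finset.sum_neg_distrib]
  congr 1
  funext g
  ring

lemma integrable_signedSup [Nonempty G] (hG : HasMeasurableSups P G)
    (hφ : Measurable (Function.uncurry φ)) (hφc : ∀ x, Continuous (φ x))
    (hM : ∀ g ∈ G, ∀ x, |φ x (g x)| ≤ M) (σ : Fin n → ℤˣ) :
    Integrable (signedSup G φ σ) (sampleLaw P n) :=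
  Integrable.of_bound (aemeasurable_signedSup hG hφ hφc σ).aestronglyMeasurable (n * M)
    (Eventually.of_forall fun S => abs_iSup_le (abs_signed_sum_loss_le hM σ S))

lemma integrable_supGap [Nonempty G] (hG : HasMeasurableSups P G)
    (hφ : Measurable (Function.uncurry φ)) (hφc : ∀ x, Continuous (φ x))
    (hM : ∀ g ∈ G, ∀ x, |φ x (g x)| ≤ M) :
    Integrable (fun p : (Fin n → E) × (Fin n → E) => supGap G φ p.1 p.2)
      ((sampleLaw P n).prod (sampleLaw P n)) :=
  Integrable.of_bound (aemeasurable_supGap hG hφ hφc).aestronglyMeasurable (2 * (n * M))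
    (Eventually.of_forall fun p => abs_iSup_le (abs_gap_le hM p.1 p.2))

/-- **Symmetrization**. -/
theorem integral_supGap_le [Nonempty G] (hG : HasMeasurableSups P G)
    (hφ : Measurable (Function.uncurry φ)) (hφc : ∀ x, Continuous (φ x))
    (hM : ∀ g ∈ G, ∀ x, |φ x (g x)| ≤ M) :
    2 ^ n * ∫ p, supGap G φ p.1 p.2 ∂((sampleLaw P n).prod (sampleLaw P n)) ≤
      2 * ∑ σ : Fin n → ℤˣ, ∫ S, signedSup G φ σ S ∂(sampleLaw P n) := by
  have hint := integrable_supGap (n := n) hG hφ hφc hM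
  have hV := integrable_signedSup (n := n) hG hφ hφc hM
  have step : ∀ σ : Fin n → ℤˣ,
      ∫ p, supGap G φ p.1 p.2 ∂((sampleLaw P n).prod (sampleLaw P n)) ≤
        ∫ S, signedSup G φ σ S ∂(sampleLaw P n) +
          ∫ S, signedSup G φ (-σ) S ∂(sampleLaw P n) := by
    intro σ
    have hex := measurePreserving_exchange P σ
    calc ∫ p, supGap G φ p.1 p.2 ∂((sampleLaw P n).prod (sampleLaw P n))
        = ∫ p, supGap G φ (exchange σ p).1 (exchange σ p).2
            ∂((sampleLaw P n).prod (sampleLaw P n)) := by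
          conv_lhs => rw [← hex.map_eq]
          rw [integral_map hex.measurable.aemeasurable]
          rw [hex.map_eq]; exact hint.aestronglyMeasurable
      _ ≤ ∫ p, (signedSup G φ σ p.2 + signedSup G φ (-σ) p.1)
            ∂((sampleLaw P n).prod (sampleLaw P n)) :=
          integral_mono (hex.integrable_comp_of_integrable hint)
            (((hV σ).comp_snd _).add ((hV (-σ)).comp_fst _)) (supGap_exchange_le hM σ)
      _ = _ := by
          rw [integral_add ((hV σ).comp_snd _) ((hV (-σ)).comp_fst _),
            integral_fun_snd, integral_fun_fst]
          simp
  -- The bound holds for each fixed `σ`, so it may be summed over all `2 ^ n` sign vectors; the flip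
  -- `σ ↦ -σ` then merges the two sums, whence the factor 2.
  have hsum := Finset.sum_le_sum fun (σ : Fin n → ℤˣ) (_ : σ ∈ Finset.univ) => step σ
  have hneg := Equiv.sum_comp (Equiv.neg (Fin n → ℤˣ))
    (fun σ => ∫ S, signedSup G φ σ S ∂(sampleLaw P n))
  simp only [Equiv.neg_apply] at hneg
  rw [Finset.sum_add_distrib, hneg] at hsum
  have hcard : Fintype.card ℤˣ = 2 := by decide
  rw [Finset.sum_const, Finset.card_univ, Fintype.card_pi] at hsum
  simp only [hcard, Finset.prod_const, Finset.card_univ, Fintype.card_fin, nsmul_eq_mul,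
    Nat.cast_pow, Nat.cast_ofNat] at hsum
  linarith

lemma natCast_mul_rademacher [Nonempty G] (hG : HasMeasurableSups P G) {Cg : ℝ}
    (hCg : ∀ g ∈ G, ∀ x, |g x| ≤ Cg) (hn : 0 < n) :
    ∑ σ : Fin n → ℤˣ, ∫ S, signedSup G (fun _ z => z) σ S ∂(sampleLaw P n) =
      2 ^ n * (n * rademacher P G n) := by
  have hU := integrable_signedSup (n := n) (φ := fun _ z => z) hG measurable_snd
    (fun _ => continuous_id) hCg
  have hrad : rademacher P G n = ∫ S, (1 / (2 : ℝ) ^ n) * ((1 / (n : ℝ)) *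
      ∑ σ : Fin n → ℤˣ, signedSup G (fun _ z => z) σ S) ∂(sampleLaw P n) := by
    refine integral_congr_ae (Eventually.of_forall fun S => ?_)
    simp only [signedSup]
    rw [Finset.mul_sum (a := 1 / (n : ℝ))]
    congr 1
    refine Finset.sum_congr rfl fun σ _ => ?_
    rw [Real.mul_iSup_of_nonneg (by positivity)]
  rw [hrad, integral_const_mul, integral_const_mul, integral_finsetSum _ fun σ _ => hU σ]
  field_simp

/-- The mean of `supGap` over two samples is at most `2 n K` times the Rademacher complexity. -/
theorem integral_supGap_le_rademacher [Nonempty G] {K : ℝ≥0} (hG : HasMeasurableSups P G)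
    (hφ : Measurable (Function.uncurry φ)) (hM : ∀ g ∈ G, ∀ x, |φ x (g x)| ≤ M) {Cg : ℝ}
    (hCg : ∀ g ∈ G, ∀ x, |g x| ≤ Cg) (hK : ∀ x, LipschitzWith K (φ x)) (hn : 0 < n) :
    ∫ p, supGap G φ p.1 p.2 ∂((sampleLaw P n).prod (sampleLaw P n)) ≤
      2 * K * n * rademacher P G n := by
  have hφc : ∀ x, Continuous (φ x) := fun x => (hK x).continuous
  have hV := integrable_signedSup (n := n) hG hφ hφc hM
  have hU := integrable_signedSup (n := n) (φ := fun _ z => z) hG measurable_snd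
    (fun _ => continuous_id) hCg
  have h1 := integral_supGap_le (n := n) hG hφ hφc hM
  have h2 : ∑ σ : Fin n → ℤˣ, ∫ S, signedSup G φ σ S ∂(sampleLaw P n) ≤
      K * (2 ^ n * (n * rademacher P G n)) := by
    rw [← natCast_mul_rademacher hG hCg hn, ← integral_finsetSum _ fun σ _ => hV σ,
      ← integral_finsetSum _ fun σ _ => hU σ, ← integral_const_mul]
    exact integral_mono (integrable_finsetSum _ fun σ _ => hV σ)
      ((integrable_finsetSum _ fun σ _ => hU σ).const_mul _) (sum_signedSup_le_mul hM hCg hK)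
  refine le_of_mul_le_mul_left (a := (2 : ℝ) ^ n) ?_ (by positivity)
  linarith

end Gap

/-! ### Uniform one-sided deviation -/

section UniformDeviation

variable {E : Type*} [MeasurableSpace E]

/-- Turns a null-measurable good event and an almost sure property into a genuinely measurable event
of the same probability. -/
lemma exists_measurableSet_forall_and {Ω : Type*} [MeasurableSpace Ω] {μ : Measure Ω}
    {A : Set Ω} (hA : NullMeasurableSet A μ) {q : Ω → Prop} (hq : ∀ᵐ ω ∂μ, q ω) :
    ∃ A' ⊆ A, MeasurableSet A' ∧ μ.real A' = μ.real A ∧ ∀ ω ∈ A', q ω := by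
  have hae : (A ∩ {ω | q ω} : Set Ω) =ᵐ[μ] A := by
    filter_upwards [hq] with ω hω
    exact propext ⟨fun h => h.1, fun h => ⟨h, hω⟩⟩
  obtain ⟨A', hsub, hmeas, heq⟩ := (hA.congr hae.symm).exists_measurable_subset_ae_eq
  exact ⟨A', fun ω h => (hsub h).1, hmeas, measureReal_congr (heq.trans hae),
    fun ω h => (hsub h).2⟩

/-- The mean of `supGap G φ S T` over an independent sample `T`. -/
noncomputable def meanGap (P : Measure E) (G : Set (E → ℝ)) (φ : E → ℝ → ℝ) {n : ℕ}
    (S : Fin n → E) : ℝ :=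
  (∫⁻ T, ENNReal.ofReal (supGap G φ S T) ∂(sampleLaw P n)).toReal

variable {P : Measure E} {G : Set (E → ℝ)} {g₀ : E → ℝ} {φ : E → ℝ → ℝ} {M : ℝ} {n : ℕ}
  [IsProbabilityMeasure P]

lemma lintegral_supGap_le [Nonempty G] (hM : ∀ g ∈ G, ∀ x, |φ x (g x)| ≤ M) (S : Fin n → E) :
    ∫⁻ T, ENNReal.ofReal (supGap G φ S T) ∂(sampleLaw P n) ≤ ENNReal.ofReal (2 * (n * M)) :=
  (lintegral_mono fun T => ENNReal.ofReal_le_ofReal (supGap_le hM S T)).trans (by simp)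

lemma meanGap_update_le [Nonempty G] (hM : ∀ g ∈ G, ∀ x, |φ x (g x)| ≤ M) (hM0 : 0 ≤ M)
    (S : Fin n → E) (i : Fin n) (x : E) :
    meanGap P G φ (Function.update S i x) ≤ meanGap P G φ S + 2 * M := by
  have hfin : ∀ S : Fin n → E, ∫⁻ T, ENNReal.ofReal (supGap G φ S T) ∂(sampleLaw P n) ≠ ∞ :=
    fun S => ((lintegral_supGap_le hM S).trans_lt ENNReal.ofReal_lt_top).ne
  have h : ∫⁻ T, ENNReal.ofReal (supGap G φ (Function.update S i x) T) ∂(sampleLaw P n)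
      ≤ ∫⁻ T, ENNReal.ofReal (supGap G φ S T) ∂(sampleLaw P n) + ENNReal.ofReal (2 * M) := by
    calc _ ≤ ∫⁻ T, (ENNReal.ofReal (supGap G φ S T) + ENNReal.ofReal (2 * M)) ∂(sampleLaw P n) :=
          lintegral_mono fun T => (ENNReal.ofReal_le_ofReal
            (supGap_update_le hM S T i x)).trans ENNReal.ofReal_add_le
      _ = _ := by rw [lintegral_add_right _ measurable_const]; simp
  have := ENNReal.toReal_mono (ENNReal.add_ne_top.2 ⟨hfin S, ENNReal.ofReal_ne_top⟩) h
  rwa [ENNReal.toReal_add (hfin S) ENNReal.ofReal_ne_top, ENNReal.toReal_ofReal (by positivity)] at this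

lemma aemeasurable_meanGap (hG : HasMeasurableSups P G) (hφ : Measurable (Function.uncurry φ))
    (hφc : ∀ x, Continuous (φ x)) :
    AEMeasurable (meanGap P G φ (n := n)) (sampleLaw P n) :=
  ((aemeasurable_supGap hG hφ hφc).ennreal_ofReal.lintegral_prod_right').ennreal_toReal

lemma ae_meanGap_eq (hG : HasMeasurableSups P G) (hφ : Measurable (Function.uncurry φ))
    (hφc : ∀ x, Continuous (φ x)) (hM : ∀ g ∈ G, ∀ x, |φ x (g x)| ≤ M) (hg₀ : g₀ ∈ G)
    (hφ₀ : ∀ x, φ x (g₀ x) = 0) :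
    ∀ᵐ S ∂(sampleLaw P n), Integrable (supGap G φ S) (sampleLaw P n) ∧
      meanGap P G φ S = ∫ T, supGap G φ S T ∂(sampleLaw P n) := by
  have : Nonempty G := ⟨⟨g₀, hg₀⟩⟩
  filter_upwards [(integrable_supGap (n := n) hG hφ hφc hM).prod_right_ae] with S hS
  exact ⟨hS, (integral_eq_lintegral_of_nonneg_ae
    (Eventually.of_forall fun T => supGap_nonneg hM hg₀ hφ₀ S T) hS.aestronglyMeasurable).symm⟩

lemma integral_sum_loss (hφ : Measurable (Function.uncurry φ))
    (hM : ∀ g ∈ G, ∀ x, |φ x (g x)| ≤ M) {g : E → ℝ} (hg : g ∈ G) (hgm : Measurable g) :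
    Integrable (fun T : Fin n → E => ∑ i, φ (T i) (g (T i))) (sampleLaw P n) ∧
      ∫ T, ∑ i, φ (T i) (g (T i)) ∂(sampleLaw P n) = n * ∫ x, φ x (g x) ∂P := by
  have hmeas : Measurable fun x => φ x (g x) := hφ.comp (measurable_id.prodMk hgm)
  have hint : Integrable (fun x => φ x (g x)) P :=
    Integrable.of_bound hmeas.aestronglyMeasurable M (Eventually.of_forall fun x => hM g hg x)
  have hev : ∀ i : Fin n, MeasurePreserving (Function.eval i) (sampleLaw P n) P := fun i =>
    measurePreserving_eval (fun _ => P) i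
  have hi : ∀ i : Fin n, Integrable (fun T : Fin n → E => φ (T i) (g (T i))) (sampleLaw P n) :=
    fun i => (hev i).integrable_comp_of_integrable hint
  refine ⟨integrable_finsetSum _ fun i _ => hi i, ?_⟩
  rw [integral_finsetSum _ fun i _ => hi i]
  have : ∀ i : Fin n, ∫ T, φ (T i) (g (T i)) ∂(sampleLaw P n) = ∫ x, φ x (g x) ∂P := fun i => by
    conv_rhs => rw [← (hev i).map_eq]
    rw [integral_map (hev i).measurable.aemeasurable hmeas.aestronglyMeasurable]
  simp [this]

/-- With high probability, the means of the losses `φ x (g x)` exceed the empirical means by at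
most twice the Rademacher complexity and a deviation term, uniformly over the class. -/
theorem exists_uniform_deviation_bound (hG : HasMeasurableSups P G)
    (hGm : ∀ g ∈ G, Measurable g) {Cg : ℝ} (hCg : ∀ g ∈ G, ∀ x, |g x| ≤ Cg) {K : ℝ≥0}
    (hφ : Measurable (Function.uncurry φ)) (hK : ∀ x, LipschitzWith K (φ x)) (hM0 : 0 < M)
    (hM : ∀ g ∈ G, ∀ x, |φ x (g x)| ≤ M) (hg₀ : g₀ ∈ G) (hφ₀ : ∀ x, φ x (g₀ x) = 0)
    (hn : 0 < n) {δ : ℝ} (hδ : 0 < δ) :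
    ∃ A : Set (Fin n → E), MeasurableSet A ∧ 1 - δ ≤ (sampleLaw P n).real A ∧
      ∀ S ∈ A, ∀ g ∈ G, ∫ x, φ x (g x) ∂P ≤ (1 / (n : ℝ)) * ∑ i, φ (S i) (g (S i)) +
        (2 * K * rademacher P G n + 2 * M * √(Real.log (1 / δ) / (2 * n))) := by
  rcases le_or_gt 1 δ with h1 | h1
  -- For `δ ≥ 1` the required probability is at most zero. Otherwise `log (1 / δ)` is nonnegative.
  · exact ⟨∅, MeasurableSet.empty, by simpa using h1, by simp⟩
  have : Nonempty G := ⟨⟨g₀, hg₀⟩⟩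
  have hφc : ∀ x, Continuous (φ x) := fun x => (hK x).continuous
  have hn' : (0 : ℝ) < n := Nat.cast_pos.2 hn
  -- The factor `n` appears because gaps are unnormalized sums. With differences bounded by `2 * M`,
  -- this `ε` makes McDiarmid's tail exactly `δ`.
  set ε : ℝ := n * (2 * M * √(Real.log (1 / δ) / (2 * n))) with hε
  have hlog : 0 ≤ Real.log (1 / δ) := Real.log_nonneg (by rw [le_div_iff₀ hδ]; linarith)
  have hε0 : 0 ≤ ε := by positivity
  have hΨ := aemeasurable_meanGap (n := n) hG hφ hφc
  have hae := ae_meanGap_eq (n := n) hG hφ hφc hM hg₀ hφ₀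
  have hmean : ∫ S, meanGap P G φ S ∂(sampleLaw P n) ≤ 2 * K * n * rademacher P G n := by
    refine le_trans (le_of_eq ?_) (integral_supGap_le_rademacher hG hφ hM hCg hK hn)
    rw [integral_prod _ (integrable_supGap hG hφ hφc hM)]
    exact integral_congr_ae (hae.mono fun S h => h.2)
  have htail := measure_ge_le_of_bounded_differences (P := P) (n := n) (c := 2 * M)
    (B := 2 * (n * M)) (by positivity) hΨ (fun S => ENNReal.toReal_nonneg)
    (fun S => ENNReal.toReal_le_of_le_ofReal (by positivity) (lintegral_supGap_le hM S))
    (meanGap_update_le hM hM0.le) hε0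
  have hexp : Real.exp (-ε ^ 2 / (2 * (n * (2 * M / 2) ^ 2))) = δ := by
    rw [hε, mul_pow, mul_pow, Real.sq_sqrt (by positivity)]
    have : -((n : ℝ) ^ 2 * ((2 * M) ^ 2 * (Real.log (1 / δ) / (2 * n)))) /
        (2 * (n * (2 * M / 2) ^ 2)) = Real.log δ := by
      rw [one_div, Real.log_inv]; field_simp
    rw [this, Real.exp_log hδ]
  rw [hexp] at htail
  have hnull : NullMeasurableSet
      {S | ε ≤ meanGap P G φ S - ∫ T, meanGap P G φ T ∂(sampleLaw P n)} (sampleLaw P n) :=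
    nullMeasurableSet_le aemeasurable_const (hΨ.sub_const _)
  obtain ⟨A, hAsub, hAm, hAμ, hAae⟩ := exists_measurableSet_forall_and hnull.compl hae
  refine ⟨A, hAm, ?_, fun S hS g hg => ?_⟩
  · rw [hAμ, measureReal_compl₀ hnull, probReal_univ]
    linarith
  · have hlt : meanGap P G φ S - ∫ T, meanGap P G φ T ∂(sampleLaw P n) < ε :=
      not_le.1 (hAsub hS)
    obtain ⟨hint, heq⟩ := hAae S hS
    obtain ⟨hgi, hge⟩ := integral_sum_loss (P := P) (n := n) hφ hM hg (hGm g hg)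
    -- The supremum of the means over the ghost sample `T` is at most the mean of the supremum.
    have hgap : n * ∫ x, φ x (g x) ∂P - ∑ i, φ (S i) (g (S i)) ≤ meanGap P G φ S := by
      rw [heq, ← hge]
      have h := integral_mono (hgi.sub (integrable_const (∑ i, φ (S i) (g (S i))))) hint
        fun T => le_ciSup (bddAbove_of_abs_le ⟨_, abs_gap_le hM S T⟩) ⟨g, hg⟩
      simp only [Pi.sub_apply] at h
      rw [integral_sub hgi (integrable_const _)] at h
      simpa using h
    refine le_of_mul_le_mul_left (a := (n : ℝ)) ?_ hn'
    have : (n : ℝ) * ((1 / (n : ℝ)) * ∑ i, φ (S i) (g (S i)) +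
        (2 * K * rademacher P G n + 2 * M * √(Real.log (1 / δ) / (2 * n)))) =
        ∑ i, φ (S i) (g (S i)) + 2 * K * n * rademacher P G n + ε := by
      rw [hε]; field_simp; ring
    rw [this]
    linarith

end UniformDeviation

/-! ### Laws of positive and negative patterns -/

section RiskIdentity

variable {E : Type*} [MeasurableSpace E] {μ : Measure (E × ℤˣ)} {r : E → ℝ} {Cr : ℝ}

lemma measurableSet_positive : MeasurableSet (Prod.snd ⁻¹' {1} : Set (E × ℤˣ)) := by
  have h : MeasurableSet ({1} : Set ℤˣ) := ⟨{1}, measurableSet_singleton 1, by ext y; simp⟩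
  exact measurable_snd h

lemma map_restrict_positive (hr : IsConfidence μ r) :
    (μ.restrict (Prod.snd ⁻¹' {1})).map Prod.fst =
      μ.fst.withDensity fun x => ENNReal.ofReal (r x) := by
  ext A hA
  rw [Measure.map_apply measurable_fst hA, Measure.restrict_apply (measurable_fst hA),
    withDensity_apply _ hA, ← hr.measure_eq A hA, Set.prod_eq]

lemma posDist_eq (hr : IsConfidence μ r) :
    posDist μ = (μ (Prod.snd ⁻¹' {1}))⁻¹ • μ.fst.withDensity fun x => ENNReal.ofReal (r x) := by
  rw [posDist, ProbabilityTheory.cond, Measure.map_smul, map_restrict_positive hr]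

lemma posDist_absolutelyContinuous (hr : IsConfidence μ r) : posDist μ ≪ μ.fst := by
  rw [posDist_eq hr]
  exact (withDensity_absolutelyContinuous _ _).smul_left _

variable [IsProbabilityMeasure μ]

/-- Obtained by subtracting the positive part from the marginal law, which is legitimate because the
measures are finite. -/
lemma map_restrict_negative (hr : IsConfidence μ r) :
    (μ.restrict (Prod.snd ⁻¹' {1})ᶜ).map Prod.fst =
      μ.fst.withDensity fun x => ENNReal.ofReal (1 - r x) := by
  ext A hA
  have hm : Measurable fun x => ENNReal.ofReal (r x) := hr.measurable.ennreal_ofReal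
  have hsum : ∫⁻ x in A, ENNReal.ofReal (1 - r x) ∂μ.fst + ∫⁻ x in A, ENNReal.ofReal (r x) ∂μ.fst
      = μ.fst A := by
    rw [← lintegral_add_right _ hm, ← setLIntegral_one]
    refine lintegral_congr fun x => ?_
    rw [← ENNReal.ofReal_add (by linarith [(hr.mem_Icc x).2]) (hr.mem_Icc x).1]
    simp
  have hsplit : μ (Prod.fst ⁻¹' A ∩ (Prod.snd ⁻¹' {1})ᶜ) +
      ∫⁻ x in A, ENNReal.ofReal (r x) ∂μ.fst = μ.fst A := by
    rw [← hr.measure_eq A hA, Measure.fst_apply hA, Set.prod_eq, add_comm, ← sdiff_eq,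
      measure_inter_add_sdiff _ measurableSet_positive]
  rw [Measure.map_apply measurable_fst hA, Measure.restrict_apply (measurable_fst hA),
    withDensity_apply _ hA]
  have hne : ∫⁻ x in A, ENNReal.ofReal (r x) ∂μ.fst ≠ ∞ := by
    rw [← hr.measure_eq A hA]; exact measure_ne_top _ _
  exact (ENNReal.add_left_inj hne).1 (hsplit.trans hsum.symm)

lemma integral_withDensity_ofReal {ν : Measure E} {w : E → ℝ} (hw : Measurable w)
    (h0 : ∀ x, 0 ≤ w x) (h : E → ℝ) :
    ∫ x, h x ∂(ν.withDensity fun x => ENNReal.ofReal (w x)) = ∫ x, w x * h x ∂ν := by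
  rw [integral_withDensity_eq_integral_toReal_smul hw.ennreal_ofReal
    (Eventually.of_forall fun x => ENNReal.ofReal_lt_top)]
  simp [ENNReal.toReal_ofReal (h0 _)]

lemma prior_pos (hr : IsConfidence μ r) (hCr : 0 < Cr) (hge : ∀ᵐ x ∂μ.fst, Cr ≤ r x) :
    0 < prior μ := by
  have h : ENNReal.ofReal Cr ≤ μ (Prod.snd ⁻¹' {1}) := by
    have h1 := hr.measure_eq univ MeasurableSet.univ
    rw [univ_prod, Measure.restrict_univ] at h1
    rw [h1]
    calc ENNReal.ofReal Cr = ∫⁻ _, ENNReal.ofReal Cr ∂μ.fst := by simp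
      _ ≤ _ := lintegral_mono_ae (hge.mono fun x hx => ENNReal.ofReal_le_ofReal hx)
  exact ENNReal.toReal_pos ((ENNReal.ofReal_pos.2 hCr).trans_le h).ne' (measure_ne_top _ _)

lemma isProbabilityMeasure_posDist (hπ : 0 < prior μ) : IsProbabilityMeasure (posDist μ) := by
  have : IsProbabilityMeasure (ProbabilityTheory.cond μ (Prod.snd ⁻¹' {1})) :=
    cond_isProbabilityMeasure (fun h => by simp [prior, measureReal_def, h] at hπ)
  exact Measure.isProbabilityMeasure_map measurable_fst.aemeasurable

lemma prior_mul_integral (hr : IsConfidence μ r) (hπ : 0 < prior μ) (h : E → ℝ) :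
    prior μ * ∫ x, h x ∂(posDist μ) = ∫ x, r x * h x ∂μ.fst := by
  rw [posDist_eq hr, integral_smul_measure,
    integral_withDensity_ofReal hr.measurable fun x => (hr.mem_Icc x).1, ENNReal.toReal_inv,
    smul_eq_mul, ← mul_assoc]
  have : prior μ * (μ (Prod.snd ⁻¹' {1})).toReal⁻¹ = 1 := mul_inv_cancel₀ hπ.ne'
  rw [this, one_mul]

/-- The integral splits by label, and the two parts have marginal densities `r` and `1 - r`. -/
lemma risk_eq {ℓ : ℝ → ℝ} {C : ℝ} {g : E → ℝ} (hr : IsConfidence μ r)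
    (hp : Measurable fun x => ℓ (g x)) (hm : Measurable fun x => ℓ (-g x))
    (hpb : ∀ x, |ℓ (g x)| ≤ C) (hmb : ∀ x, |ℓ (-g x)| ≤ C) :
    risk μ ℓ g = ∫ x, (r x * ℓ (g x) + (1 - r x) * ℓ (-g x)) ∂μ.fst := by
  have hrb : ∀ x, |r x| ≤ 1 := fun x =>
    abs_le.2 ⟨by linarith [(hr.mem_Icc x).1], (hr.mem_Icc x).2⟩
  have hrb' : ∀ x, |1 - r x| ≤ 1 := fun x =>
    abs_le.2 ⟨by linarith [(hr.mem_Icc x).2], by linarith [(hr.mem_Icc x).1]⟩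
  have bound : ∀ a b : ℝ, |a| ≤ 1 → |b| ≤ C → ‖a * b‖ ≤ 1 * C := fun a b ha hb => by
    rw [Real.norm_eq_abs, abs_mul]
    exact mul_le_mul ha hb (abs_nonneg _) zero_le_one
  have hpi : Integrable (fun x => r x * ℓ (g x)) μ.fst :=
    Integrable.of_bound (hr.measurable.mul hp).aestronglyMeasurable _
      (Eventually.of_forall fun x => bound _ _ (hrb x) (hpb x))
  have hmi : Integrable (fun x => (1 - r x) * ℓ (-g x)) μ.fst :=
    Integrable.of_bound ((measurable_const.sub hr.measurable).mul hm).aestronglyMeasurable _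
      (Eventually.of_forall fun x => bound _ _ (hrb' x) (hmb x))
  have hpos : ∀ p ∈ (Prod.snd ⁻¹' {1} : Set (E × ℤˣ)), ℓ (sgn p.2 * g p.1) = ℓ (g p.1) := by
    intro p hp
    rw [show p.2 = 1 from hp, sgn_one, one_mul]
  have hneg : ∀ p ∈ (Prod.snd ⁻¹' {1} : Set (E × ℤˣ))ᶜ,
      ℓ (sgn p.2 * g p.1) = ℓ (-g p.1) := by
    intro p hp
    rw [(Int.units_eq_one_or p.2).resolve_left hp, sgn_neg_one, neg_one_mul]
  have hint : Integrable (fun p : E × ℤˣ => ℓ (sgn p.2 * g p.1)) μ := by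
    have h1 : Integrable (fun p : E × ℤˣ => ℓ (g p.1)) μ :=
      Integrable.of_bound (hp.comp measurable_fst).aestronglyMeasurable C
        (Eventually.of_forall fun p => hpb p.1)
    have h2 : Integrable (fun p : E × ℤˣ => ℓ (-g p.1)) μ :=
      Integrable.of_bound (hm.comp measurable_fst).aestronglyMeasurable C
        (Eventually.of_forall fun p => hmb p.1)
    rw [← integrableOn_univ, ← union_compl_self (Prod.snd ⁻¹' {1} : Set (E × ℤˣ))]
    exact (h1.integrableOn.congr_fun (fun p hp => (hpos p hp).symm) measurableSet_positive).union
      (h2.integrableOn.congr_fun (fun p hp => (hneg p hp).symm) measurableSet_positive.compl)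
  rw [risk, ← integral_add_compl measurableSet_positive hint,
    setIntegral_congr_fun measurableSet_positive hpos,
    setIntegral_congr_fun measurableSet_positive.compl hneg, integral_add hpi hmi,
    ← integral_withDensity_ofReal hr.measurable (fun x => (hr.mem_Icc x).1),
    ← integral_withDensity_ofReal (w := fun x => 1 - r x) (measurable_const.sub hr.measurable)
      (fun x => by linarith [(hr.mem_Icc x).2] : ∀ x, 0 ≤ 1 - r x),
    ← map_restrict_positive hr, ← map_restrict_negative hr,
    integral_map measurable_fst.aemeasurable hp.aestronglyMeasurable,
    integral_map measurable_fst.aemeasurable hm.aestronglyMeasurable]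

end RiskIdentity

/-! ### The positive-confidence loss -/

section PconfLoss

variable {E : Type*} {ℓ : ℝ → ℝ} {Cg Cℓ Cr : ℝ} {L : ℝ≥0} {r : E → ℝ}

/-- The loss `ℓ` on `[-C, C]`, extended by constants. -/
noncomputable def clampLoss (ℓ : ℝ → ℝ) {C : ℝ} (hC : -C ≤ C) (z : ℝ) : ℝ :=
  ℓ (projIcc (-C) C hC z)

lemma clampLoss_of_mem (hC : -Cg ≤ Cg) {z : ℝ} (hz : z ∈ Icc (-Cg) Cg) :
    clampLoss ℓ hC z = ℓ z := by
  rw [clampLoss, projIcc_of_mem hC hz]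

lemma lipschitzWith_clampLoss (hC : -Cg ≤ Cg) (hℓ : LipschitzOnWith L ℓ (Icc (-Cg) Cg)) :
    LipschitzWith L (clampLoss ℓ hC) := by
  have := hℓ.to_restrict.comp (LipschitzWith.projIcc hC)
  rwa [mul_one] at this

/-- The weight `(1 - r) / r` of the negative loss, where the confidence `r` is at least `Cr`. -/
noncomputable def negWeight (r : E → ℝ) (Cr : ℝ) (x : E) : ℝ :=
  if Cr ≤ r x then (1 - r x) / r x else 0

lemma negWeight_mem_Icc (hCr : 0 < Cr) (hr : ∀ x, r x ∈ Icc (0 : ℝ) 1) (x : E) :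
    negWeight r Cr x ∈ Icc 0 (1 / Cr) := by
  unfold negWeight
  split_ifs with h
  · refine ⟨div_nonneg (by linarith [(hr x).2]) (hr x).1, ?_⟩
    exact div_le_div₀ zero_le_one (by linarith [(hr x).1]) hCr h
  · exact ⟨le_rfl, by positivity⟩

lemma measurable_negWeight [MeasurableSpace E] (hr : Measurable r) :
    Measurable (negWeight r Cr) :=
  Measurable.ite (measurableSet_le measurable_const hr)
    ((measurable_const.sub hr).div hr) measurable_const

/-- The loss whose mean under the law of positive patterns is proportional to the risk. -/
noncomputable def pconfLoss (ℓ : ℝ → ℝ) {C : ℝ} (hC : -C ≤ C) (r : E → ℝ) (Cr : ℝ) (x : E)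
    (z : ℝ) : ℝ :=
  clampLoss ℓ hC z + negWeight r Cr x * clampLoss ℓ hC (-z)

lemma pconfLoss_mem_Icc (hC : -Cg ≤ Cg) (hCr : 0 < Cr) (hr : ∀ x, r x ∈ Icc (0 : ℝ) 1)
    (h0 : ∀ z ∈ Icc (-Cg) Cg, 0 ≤ ℓ z) (h1 : ∀ z ∈ Icc (-Cg) Cg, ℓ z ≤ Cℓ) (x : E) (z : ℝ) :
    pconfLoss ℓ hC r Cr x z ∈ Icc 0 (Cℓ + Cℓ / Cr) := by
  have hw := negWeight_mem_Icc hCr hr x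
  have p0 := h0 _ (projIcc (-Cg) Cg hC z).2
  have p1 := h1 _ (projIcc (-Cg) Cg hC z).2
  have n0 := h0 _ (projIcc (-Cg) Cg hC (-z)).2
  have n1 := h1 _ (projIcc (-Cg) Cg hC (-z)).2
  refine ⟨add_nonneg p0 (mul_nonneg hw.1 n0), add_le_add p1 ?_⟩
  calc _ ≤ 1 / Cr * Cℓ := mul_le_mul hw.2 n1 n0 (by positivity)
    _ = _ := by ring

/-- Clamping makes the loss Lipschitz on the whole line, and truncating the weight bounds it by `1 /
Cr` at every `x`, so the constant is uniform without exceptional points. -/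
lemma lipschitzWith_pconfLoss (hC : -Cg ≤ Cg) (hCr : 0 < Cr) (hr : ∀ x, r x ∈ Icc (0 : ℝ) 1)
    (hℓ : LipschitzOnWith L ℓ (Icc (-Cg) Cg)) (x : E) :
    LipschitzWith (L + L / Cr.toNNReal) (pconfLoss ℓ hC r Cr x) := by
  have hw := negWeight_mem_Icc hCr hr x
  have hl := lipschitzWith_clampLoss hC hℓ
  refine LipschitzWith.of_dist_le_mul fun z z' => ?_
  have h1 := hl.dist_le_mul z z'
  have h2 := hl.dist_le_mul (-z) (-z')
  rw [dist_neg_neg] at h2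
  rw [NNReal.coe_add, NNReal.coe_div, Real.coe_toNNReal _ hCr.le]
  simp only [Real.dist_eq] at *
  calc |pconfLoss ℓ hC r Cr x z - pconfLoss ℓ hC r Cr x z'|
      = |(clampLoss ℓ hC z - clampLoss ℓ hC z') +
          negWeight r Cr x * (clampLoss ℓ hC (-z) - clampLoss ℓ hC (-z'))| := by
        unfold pconfLoss; ring_nf
    _ ≤ |clampLoss ℓ hC z - clampLoss ℓ hC z'| +
          negWeight r Cr x * |clampLoss ℓ hC (-z) - clampLoss ℓ hC (-z')| := by
        refine (abs_add_le _ _).trans ?_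
        rw [abs_mul, abs_of_nonneg hw.1]
    _ ≤ L * |z - z'| + 1 / Cr * (L * |z - z'|) :=
        add_le_add h1 (mul_le_mul hw.2 h2 (abs_nonneg _) (by positivity))
    _ = _ := by ring

lemma measurable_pconfLoss [MeasurableSpace E] (hC : -Cg ≤ Cg) (hr : Measurable r)
    (hℓ : LipschitzOnWith L ℓ (Icc (-Cg) Cg)) :
    Measurable (Function.uncurry (pconfLoss ℓ hC r Cr)) := by
  have hl := (lipschitzWith_clampLoss hC hℓ).continuous.measurable
  exact (hl.comp measurable_snd).add
    (((measurable_negWeight hr).comp measurable_fst).mul (hl.comp measurable_snd.neg))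

lemma pconfLoss_of_le (hC : -Cg ≤ Cg) {x : E} (hx : Cr ≤ r x) {z : ℝ} (hz : |z| ≤ Cg) :
    pconfLoss ℓ hC r Cr x z = ℓ z + (1 - r x) / r x * ℓ (-z) := by
  have hz' := abs_le.1 hz
  rw [pconfLoss, negWeight, if_pos hx, clampLoss_of_mem hC hz',
    clampLoss_of_mem hC ⟨by linarith, by linarith⟩]

variable [MeasurableSpace E] {μ : Measure (E × ℤˣ)} [IsProbabilityMeasure μ]

/-- The positive-confidence expression of the classification risk. -/
theorem risk_eq_prior_mul_integral (hC : -Cg ≤ Cg) (hCr : 0 < Cr) (hr : IsConfidence μ r)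
    (h0 : ∀ z ∈ Icc (-Cg) Cg, 0 ≤ ℓ z) (h1 : ∀ z ∈ Icc (-Cg) Cg, ℓ z ≤ Cℓ)
    (hℓ : LipschitzOnWith L ℓ (Icc (-Cg) Cg)) (hge : ∀ᵐ x ∂μ.fst, Cr ≤ r x)
    {g : E → ℝ} (hgm : Measurable g) (hg : ∀ x, |g x| ≤ Cg) :
    risk μ ℓ g = prior μ * ∫ x, pconfLoss ℓ hC r Cr x (g x) ∂(posDist μ) := by
  have hl := (lipschitzWith_clampLoss hC hℓ).continuous.measurable
  have hmem : ∀ x, g x ∈ Icc (-Cg) Cg := fun x => abs_le.1 (hg x)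
  have hmem' : ∀ x, -g x ∈ Icc (-Cg) Cg := fun x =>
    ⟨by linarith [(hmem x).2], by linarith [(hmem x).1]⟩
  have hp : Measurable fun x => ℓ (g x) := by
    simpa only [Function.comp_def, clampLoss_of_mem hC (hmem _)] using hl.comp hgm
  have hm : Measurable fun x => ℓ (-g x) := by
    simpa only [Function.comp_def, Pi.neg_apply, clampLoss_of_mem hC (hmem' _)] using hl.comp hgm.neg
  rw [risk_eq hr hp hm (C := Cℓ)
    (fun x => by rw [abs_of_nonneg (h0 _ (hmem x))]; exact h1 _ (hmem x))
    (fun x => by rw [abs_of_nonneg (h0 _ (hmem' x))]; exact h1 _ (hmem' x)),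
    prior_mul_integral hr (prior_pos hr hCr hge)]
  -- Where `r x ≥ Cr > 0` the truncation is inactive and multiplying by `r x` cancels the
  -- denominator of the weight.
  refine integral_congr_ae (hge.mono fun x hx => ?_)
  have : r x ≠ 0 := (hCr.trans_le hx).ne'
  simp only [pconfLoss_of_le hC hx (hg x)]
  field_simp

end PconfLoss

/-! ### Estimation error and consistency -/

section EstimationError

variable {E : Type*} [MeasurableSpace E] {μ : Measure (E × ℤˣ)}
  {r : E → ℝ} {G : Set (E → ℝ)} {ℓ : ℝ → ℝ} {Cg Cℓ Cr : ℝ} {L : ℝ≥0} {gstar : E → ℝ}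

lemma ae_forall_sample {P : Measure E} [IsProbabilityMeasure P] {p : E → Prop}
    (hp : ∀ᵐ x ∂P, p x) (n : ℕ) : ∀ᵐ S ∂(sampleLaw P n), ∀ i, p (S i) :=
  ae_all_iff.2 fun i =>
    (measurePreserving_eval (fun _ : Fin n => P) i).quasiMeasurePreserving.ae hp

lemma empRisk_eq (hC : -Cg ≤ Cg) {n : ℕ} {S : Fin n → E} (hS : ∀ i, Cr ≤ r (S i)) {g : E → ℝ}
    (hg : ∀ x, |g x| ≤ Cg) :
    empRisk μ r ℓ S g = prior μ * ((1 / (n : ℝ)) * ∑ i, pconfLoss ℓ hC r Cr (S i) (g (S i))) := by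
  simp only [empRisk, pconfLoss_of_le hC (hS _) (hg _)]

variable [IsProbabilityMeasure μ]

/-- The estimation error bound for minimizers of the empirical positive-confidence risk. -/
theorem exists_estimation_error_bound (hr : IsConfidence μ r) (hGmeas : ∀ g ∈ G, Measurable g)
    (hGsup : HasMeasurableSups (posDist μ) G) (hCg : 0 < Cg) (hCℓ : 0 < Cℓ) (hCr : 0 < Cr)
    (hG : ∀ g ∈ G, ∀ x, |g x| ≤ Cg) (h0 : ∀ z ∈ Icc (-Cg) Cg, 0 ≤ ℓ z)
    (h1 : ∀ z ∈ Icc (-Cg) Cg, ℓ z ≤ Cℓ) (hℓ : LipschitzOnWith L ℓ (Icc (-Cg) Cg))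
    (hge : ∀ᵐ x ∂μ.fst, Cr ≤ r x) (hgstar : gstar ∈ G) {n : ℕ} (hn : 0 < n) {δ : ℝ}
    (hδ : 0 < δ) :
    ∃ A : Set (Fin n → E), MeasurableSet A ∧ 1 - δ ≤ (sampleLaw (posDist μ) n).real A ∧
      ∀ S ∈ A, ∀ ghat, IsMinimizer (empRisk μ r ℓ S) G ghat →
        risk μ ℓ ghat - risk μ ℓ gstar ≤
          4 * prior μ * (L + L / Cr) * rademacher (posDist μ) G n +
          2 * prior μ * (Cℓ + Cℓ / Cr) * √(Real.log (2 / δ) / (2 * n)) := by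
  have hπ := prior_pos hr hCr hge
  have := isProbabilityMeasure_posDist hπ
  have hC : -Cg ≤ Cg := by linarith
  have hloss := pconfLoss_mem_Icc hC hCr hr.mem_Icc h0 h1
  have hmeas := measurable_pconfLoss (Cr := Cr) hC hr.measurable hℓ
  -- Centring at `gstar` makes one uniform one-sided bound enough, with no separate deviation bound
  -- for `gstar`. It leaves the Lipschitz constant unchanged, and differences of two values in `[0,
  -- M]` are still bounded by `M`.
  set φ : E → ℝ → ℝ := fun x z => pconfLoss ℓ hC r Cr x z - pconfLoss ℓ hC r Cr x (gstar x)
    with hφdef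
  have hφ : Measurable (Function.uncurry φ) :=
    hmeas.sub (hmeas.comp (measurable_fst.prodMk ((hGmeas _ hgstar).comp measurable_fst)))
  have hK : ∀ x, LipschitzWith (L + L / Cr.toNNReal) (φ x) := fun x =>
    LipschitzWith.of_dist_le_mul fun z z' => by
      rw [hφdef, dist_sub_right]
      exact (lipschitzWith_pconfLoss hC hCr hr.mem_Icc hℓ x).dist_le_mul z z'
  have hM : ∀ g ∈ G, ∀ x, |φ x (g x)| ≤ Cℓ + Cℓ / Cr := fun g _ x =>
    abs_sub_le_of_nonneg_of_le (hloss x _).1 (hloss x _).2 (hloss x _).1 (hloss x _).2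
  obtain ⟨A, hAm, hAδ, hA⟩ := exists_uniform_deviation_bound hGsup hGmeas hG hφ hK
    (by positivity) hM hgstar (fun x => sub_self _) hn hδ
  -- Discards the null set of samples with some confidence below `Cr`, where the truncated loss
  -- could differ from the empirical one.
  obtain ⟨A', hsub, hAm', hAeq, hAae⟩ := exists_measurableSet_forall_and hAm.nullMeasurableSet
    (ae_forall_sample ((posDist_absolutelyContinuous hr).ae_le hge) n)
  refine ⟨A', hAm', hAδ.trans hAeq.ge, fun S hS ghat hmin => ?_⟩
  have hrisk := fun {g} (hg : g ∈ G) =>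
    risk_eq_prior_mul_integral hC hCr hr h0 h1 hℓ hge (hGmeas g hg) (hG g hg)
  have hint : ∀ g ∈ G, Integrable (fun x => pconfLoss ℓ hC r Cr x (g x)) (posDist μ) :=
    fun g hg => Integrable.of_bound
      (hmeas.comp (measurable_id.prodMk (hGmeas g hg))).aestronglyMeasurable (Cℓ + Cℓ / Cr)
      (Eventually.of_forall fun x => by
        rw [Real.norm_of_nonneg (hloss x _).1]; exact (hloss x _).2)
  have hexcess : risk μ ℓ ghat - risk μ ℓ gstar =
      prior μ * ∫ x, φ x (ghat x) ∂(posDist μ) := by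
    rw [hrisk hmin.1, hrisk hgstar, ← mul_sub,
      ← integral_sub (hint _ hmin.1) (hint _ hgstar)]
  have hemp : (1 / (n : ℝ)) * ∑ i, φ (S i) (ghat (S i)) ≤ 0 := by
    have h := hmin.2 gstar hgstar
    rw [empRisk_eq hC (hAae S hS) (hG _ hmin.1), empRisk_eq hC (hAae S hS) (hG _ hgstar)] at h
    have h' := le_of_mul_le_mul_left h hπ
    rw [hφdef, Finset.sum_sub_distrib, mul_sub]
    linarith
  have hdev := hA S (hsub hS) ghat hmin.1
  have hrad := rademacher_nonneg (P := posDist μ) (n := n) hG hgstar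
  have hsqrt : √(Real.log (1 / δ) / (2 * n)) ≤ √(Real.log (2 / δ) / (2 * n)) := by
    refine Real.sqrt_le_sqrt (div_le_div_of_nonneg_right (Real.log_le_log (by positivity) ?_)
      (by positivity))
    gcongr
    norm_num
  rw [NNReal.coe_add, NNReal.coe_div, Real.coe_toNNReal _ hCr.le] at hdev
  rw [hexcess]
  calc prior μ * ∫ x, φ x (ghat x) ∂(posDist μ)
      ≤ prior μ * (4 * (L + L / Cr) * rademacher (posDist μ) G n +
          2 * (Cℓ + Cℓ / Cr) * √(Real.log (2 / δ) / (2 * n))) := by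
        refine mul_le_mul_of_nonneg_left ?_ hπ.le
        -- The argument yields the factor 2 and `log (1 / δ)`; nonnegativity of the complexity
        -- allows 2 to be relaxed to 4.
        have hL : 0 ≤ (L + L / Cr) * rademacher (posDist μ) G n := by positivity
        have := mul_le_mul_of_nonneg_left hsqrt (by positivity : 0 ≤ 2 * (Cℓ + Cℓ / Cr))
        linarith
    _ = _ := by ring

lemma tendsto_sqrt_log_div (a : ℝ) : Tendsto (fun n : ℕ => √(a / (2 * n))) atTop (𝓝 0) := by
  have h : Tendsto (fun n : ℕ => a / (2 * (n : ℝ))) atTop (𝓝 0) :=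
    (tendsto_natCast_atTop_atTop.const_mul_atTop two_pos).const_div_atTop a
  simpa using h.sqrt

/-- The bad events `B n` need not be measurable: their outer measure is controlled by the complement
of a measurable good event. -/
lemma tendsto_measure_zero_of_high_probability_bound {Ω : ℕ → Type*}
    [∀ n, MeasurableSpace (Ω n)] {ν : ∀ n, Measure (Ω n)} [∀ n, IsProbabilityMeasure (ν n)]
    {B : ∀ n, Set (Ω n)}
    (h : ∀ δ : ℝ, 0 < δ → ∀ᶠ n in atTop, ∃ A : Set (Ω n), MeasurableSet A ∧
      1 - δ ≤ (ν n).real A ∧ Disjoint (B n) A) :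
    Tendsto (fun n => ν n (B n)) atTop (𝓝 0) := by
  rw [ENNReal.tendsto_nhds_zero]
  intro η hη
  -- Capping at 1 covers `η = ∞`, for which `toReal` would give the useless value 0.
  have hmin : min η 1 ≠ ∞ := (min_le_right _ _).trans_lt ENNReal.one_lt_top |>.ne
  have hδ : 0 < (min η 1).toReal := ENNReal.toReal_pos (lt_min hη one_pos).ne' hmin
  filter_upwards [h _ hδ] with n ⟨A, hAm, hA, hdisj⟩
  calc ν n (B n) ≤ ν n Aᶜ := measure_mono hdisj.subset_compl_right
    _ = ENNReal.ofReal ((ν n).real Aᶜ) := (ofReal_measureReal).symm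
    _ ≤ ENNReal.ofReal (min η 1).toReal := by
        refine ENNReal.ofReal_le_ofReal ?_
        rw [probReal_compl_eq_one_sub hAm]
        linarith
    _ ≤ η := by rw [ENNReal.ofReal_toReal hmin]; exact min_le_left _ _

end EstimationError

end Pconf

theorem theorem2 {d : ℕ}
    (μ : Measure (EuclideanSpace ℝ (Fin d) × ℤˣ)) [IsProbabilityMeasure μ]
    (r : EuclideanSpace ℝ (Fin d) → ℝ) (hr : Pconf.IsConfidence μ r)
    (G : Set (EuclideanSpace ℝ (Fin d) → ℝ)) (hGmeas : ∀ g ∈ G, Measurable g)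
    (hGsup : Pconf.HasMeasurableSups (Pconf.posDist μ) G)
    (ℓ : ℝ → ℝ) (Cg Cℓ Cr : ℝ) (L : ℝ≥0) (hCg : 0 < Cg) (hCℓ : 0 < Cℓ) (hCr : 0 < Cr)
    (hG : ∀ g ∈ G, ∀ x, |g x| ≤ Cg)
    (hℓ_nonneg : ∀ z ∈ Icc (-Cg) Cg, 0 ≤ ℓ z)
    (hℓ_le : ∀ z ∈ Icc (-Cg) Cg, ℓ z ≤ Cℓ)
    (hℓ_lip : LipschitzOnWith L ℓ (Icc (-Cg) Cg))
    (hr_ge : ∀ᵐ x ∂μ.fst, Cr ≤ r x)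
    (gstar : EuclideanSpace ℝ (Fin d) → ℝ)
    (hgstar : Pconf.IsMinimizer (Pconf.risk μ ℓ) G gstar) :
    (∀ n : ℕ, 0 < n → ∀ δ : ℝ, 0 < δ →
      ∃ A : Set (Fin n → EuclideanSpace ℝ (Fin d)), MeasurableSet A ∧
        1 - δ ≤ (Pconf.sampleLaw (Pconf.posDist μ) n).real A ∧
        ∀ S ∈ A, ∀ ghat, Pconf.IsMinimizer (Pconf.empRisk μ r ℓ S) G ghat →
          Pconf.risk μ ℓ ghat - Pconf.risk μ ℓ gstar ≤
            4 * Pconf.prior μ * (L + L / Cr) * Pconf.rademacher (Pconf.posDist μ) G n +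
            2 * Pconf.prior μ * (Cℓ + Cℓ / Cr) * √(Real.log (2 / δ) / (2 * n))) ∧
    (Tendsto (fun n => Pconf.rademacher (Pconf.posDist μ) G n) atTop (𝓝 0) →
      ∀ ε : ℝ, 0 < ε →
        Tendsto (fun n : ℕ => Pconf.sampleLaw (Pconf.posDist μ) n
          {S | ∃ ghat, Pconf.IsMinimizer (Pconf.empRisk μ r ℓ S) G ghat ∧
            ε < Pconf.risk μ ℓ ghat - Pconf.risk μ ℓ gstar}) atTop (𝓝 0)) := by
  have hbound := fun (n : ℕ) (hn : 0 < n) (δ : ℝ) (hδ : 0 < δ) =>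
    Pconf.exists_estimation_error_bound hr hGmeas hGsup hCg hCℓ hCr hG hℓ_nonneg hℓ_le hℓ_lip
      hr_ge hgstar.1 hn hδ
  refine ⟨hbound, fun hrad ε hε => ?_⟩
  have := Pconf.isProbabilityMeasure_posDist (Pconf.prior_pos hr hCr hr_ge)
  refine Pconf.tendsto_measure_zero_of_high_probability_bound fun δ hδ => ?_
  have hlim := (hrad.const_mul (4 * Pconf.prior μ * (L + L / Cr))).add
    ((Pconf.tendsto_sqrt_log_div (Real.log (2 / δ))).const_mul
      (2 * Pconf.prior μ * (Cℓ + Cℓ / Cr)))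
  rw [mul_zero, mul_zero, add_zero] at hlim
  -- For fixed `δ` the error bound eventually drops below `ε`, so the bad event misses the good
  -- event `A`.
  filter_upwards [hlim.eventually_lt_const hε, eventually_gt_atTop 0] with n hlt hn
  obtain ⟨A, hAm, hAδ, hA⟩ := hbound n hn δ hδ
  refine ⟨A, hAm, hAδ, Set.disjoint_left.2 ?_⟩
  rintro S ⟨ghat, hmin, hgt⟩ hS
  exact absurd (hA S hS ghat hmin) (not_le.2 (hlt.trans hgt))
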